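/- Let $X,Y$ be real Hausdorff locally convex spaces with topological duals $X^*,Y^*$, let $A:X\to Y$ be a continuous linear operator with adjoint $A^*:Y^*\to X^*$, $A^*y^*=y^*\circ A$, let $P\subset X$ and $Q\subset Y$ be convex cones (nonempty sets closed under addition and under multiplication by scalars in $[0,\infty[$), with positive dual cones $P^+=\{x^*\in X^*\mid \langle x,x^*\rangle\ge 0\ \forall x\in P\}$ and $Q^+$ (defined analogously), and let $c\in X^*$, $b\in Y$. Consider the problem $(P_{c,b})$: minimize $\langle x,c\rangle$ s.t. $x\in P$, $Ax-b\in Q$, and its dual $(P^*_{c,b})$: maximize $\langle b,y^*\rangle$ s.t. $y^*\in Q^+$, $A^*y^*-c\in -P^+$, with values in $[-\infty,\infty]$ ($\inf\emptyset=\infty$, $\sup\emptyset=-\infty$), and let $\mathrm{Sol}(P^*_{c,b})$ be the set of optimal solutions of the dual. Let $h_c:Y\to[-\infty,\infty]$, $h_c(y)=\inf\{\langle x,c\rangle\mid x\in P,\ Ax-y\in Q\}$, be the value function, and let $\partial h_c(b)$ be its subdifferential at $b$, that is, $\{y^*\in Y^*\mid \langle y-b,y^*\rangle\le h_c(y)-h_c(b)\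 \forall y\in Y\}$ if $h_c(b)\in\mathbb R$, and $\emptyset$ otherwise. For a nonempty subset $E$ of a real linear space, $\operatorname{icr}E$ is the set of all $x_0$ such that for every $x$ in the affine hull of $E$ there is $\delta>0$ with $(1-\lambda)x_0+\lambda x\in E$ for all real $\lambda$ with $|\lambda|\le\delta$. Let $Y_0=\operatorname{span}(A(P)-Q)$ be endowed with the topology induced from $Y$. Assume that one of the following conditions holds: (i) there is $\lambda_0\in\mathbb R$ such that $\{y\in Y\mid \exists x\in P:\ Ax-y\in Q,\ \langle x,c\rangle\le\lambda_0\}$ is a neighborhood of $b$ in $Y_0$; (ii) there is $x_0\in P$ such that $Ax_0-b\in\operatorname{int}_{Y_0}Q$; (iii) $X$ and $Y$ are Fréchet spaces, $P$, $Q$ and $Y_0$ are closed, and $b\in\operatorname{icr}(A(P)-Q)$; (iv) $\dim Y_0<\infty$ and $b\in\operatorname{icr}(A(P)-Q)$. Then either (a) $h_c(y)=-\infty$ for every $y\in\operatorname{icr}(A(P)-Q)$, and so $\mathrm{val}(P_{c,b})=\mathrm{val}(P^*_{c,b})=-\infty$; or (b) $c\in P^++A^*(Q^+)$ and $h_c|_{Y_0}$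 is continuous at $b$. In case (b), $\partial h_c(b)\ne\emptyset$, $\mathrm{val}(P_{c,b})=\mathrm{val}(P^*_{c,b})\in\mathbb R$, and $(P^*_{c,b})$ has optimal solutions; if moreover $Y_0=Y$, then $\mathrm{Sol}(P^*_{c,b})$ is $w^*$-compact. -/

import Mathlib

open scoped Pointwise Topology

namespace ConicLP

/-- The intrinsic core (relative algebraic interior) of a set. For nonempty `E` the clause
`x₀ ∈ E` is the case `l = 0` of the second clause; it makes the intrinsic core of `∅` empty. -/
def icr {E : Type*} [AddCommGroup E] [Module ℝ E] (S : Set E) : Set E :=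
  {x₀ | x₀ ∈ S ∧ ∀ x ∈ affineSpan ℝ S, ∃ δ : ℝ, 0 < δ ∧
    ∀ l : ℝ, |l| ≤ δ → (1 - l) • x₀ + l • x ∈ S}

/-- The interior of `S ∩ L` in the linear subspace `L`, endowed with the induced topology. -/
def interiorIn {E : Type*} [AddCommGroup E] [Module ℝ E] [TopologicalSpace E]
    (L : Submodule ℝ E) (S : Set E) : Set E :=
  (fun y : L => (y : E)) '' interior ((fun y : L => (y : E)) ⁻¹' S)

/-- A (Hausdorff) locally convex space is Fréchet if it is metrizable and complete for the
uniformity given by its additive topological group structure. -/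
def IsFrechet (E : Type*) [AddCommGroup E] [Module ℝ E] [TopologicalSpace E]
    [IsTopologicalAddGroup E] [ContinuousSMul ℝ E] [LocallyConvexSpace ℝ E] : Prop :=
  TopologicalSpace.MetrizableSpace E ∧
    @CompleteSpace E (IsTopologicalAddGroup.rightUniformSpace E)

/-- The positive dual cone of a subset of a locally convex space. -/
def posDual {E : Type*} [AddCommGroup E] [Module ℝ E] [TopologicalSpace E]
    (S : Set E) : Set (E →L[ℝ] ℝ) :=
  {f | ∀ x ∈ S, 0 ≤ f x}

open Classical in
/-- The indicator function of a set: `0` on the set and `∞` outside. -/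
noncomputable def ind {E : Type*} (S : Set E) (x : E) : EReal :=
  if x ∈ S then 0 else ⊤

/-- The subdifferential of `f` at `x`, empty if `f x` is not a real number. -/
def subdiff {E : Type*} [AddCommGroup E] [Module ℝ E] [TopologicalSpace E]
    (f : E → EReal) (x : E) : Set (E →L[ℝ] ℝ) :=
  {g | (f x ≠ ⊥ ∧ f x ≠ ⊤) ∧ ∀ x' : E, ((g (x' - x) : ℝ) : EReal) ≤ f x' - f x}

section Problem

variable {X Y : Type*}
  [AddCommGroup X] [Module ℝ X] [TopologicalSpace X]
  [AddCommGroup Y] [Module ℝ Y] [TopologicalSpace Y]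

/-- The set `A(P) - Q`. -/
def imageDiff (A : X →L[ℝ] Y) (P : PointedCone ℝ X) (Q : PointedCone ℝ Y) : Set Y :=
  A '' (P : Set X) - (Q : Set Y)

/-- The linear subspace `Y₀ = span (A(P) - Q)`. -/
def Y₀ (A : X →L[ℝ] Y) (P : PointedCone ℝ X) (Q : PointedCone ℝ Y) : Submodule ℝ Y :=
  Submodule.span ℝ (imageDiff A P Q)

/-- The perturbation function `Φ_c (x, y) = ⟨x, c⟩ + ι_P(x) + ι_Q(Ax - y)`. -/
noncomputable def perturbation (A : X →L[ℝ] Y) (P : PointedCone ℝ X) (Q : PointedCone ℝ Y)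
    (c : X →L[ℝ] ℝ) (x : X) (y : Y) : EReal :=
  ((c x : ℝ) : EReal) + ind (P : Set X) x + ind (Q : Set Y) (A x - y)

/-- The value function `h_c (y) = inf {Φ_c (x, y) | x ∈ X}`. -/
noncomputable def valueFun (A : X →L[ℝ] Y) (P : PointedCone ℝ X) (Q : PointedCone ℝ Y)
    (c : X →L[ℝ] ℝ) (y : Y) : EReal :=
  ⨅ x : X, perturbation A P Q c x y

/-- The feasible set of the primal problem: minimize `⟨x, c⟩` s.t. `x ∈ P`, `Ax - b ∈ Q`. -/
def primalFeasible (A : X →L[ℝ] Y) (P : PointedCone ℝ X) (Q : PointedCone ℝ Y)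
    (b : Y) : Set X :=
  {x | x ∈ P ∧ A x - b ∈ Q}

/-- The value of the primal problem (`∞` if it is infeasible). -/
noncomputable def primalVal (A : X →L[ℝ] Y) (P : PointedCone ℝ X) (Q : PointedCone ℝ Y)
    (c : X →L[ℝ] ℝ) (b : Y) : EReal :=
  ⨅ x ∈ primalFeasible A P Q b, ((c x : ℝ) : EReal)

/-- The adjoint operator, `A* y* = y* ∘ A`. -/
def adj (A : X →L[ℝ] Y) (g : Y →L[ℝ] ℝ) : X →L[ℝ] ℝ :=
  g.comp A

/-- The feasible set of the dual problem: maximize `⟨b, y*⟩` s.t. `y* ∈ Q⁺`,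
`A* y* - c ∈ -P⁺`. -/
def dualFeasible (A : X →L[ℝ] Y) (P : PointedCone ℝ X) (Q : PointedCone ℝ Y)
    (c : X →L[ℝ] ℝ) : Set (Y →L[ℝ] ℝ) :=
  {g | g ∈ posDual (Q : Set Y) ∧ adj A g - c ∈ -posDual (P : Set X)}

/-- The value of the dual problem (`-∞` if it is infeasible). -/
noncomputable def dualVal (A : X →L[ℝ] Y) (P : PointedCone ℝ X) (Q : PointedCone ℝ Y)
    (c : X →L[ℝ] ℝ) (b : Y) : EReal :=
  ⨆ g ∈ dualFeasible A P Q c, ((g b : ℝ) : EReal)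

/-- The set of optimal solutions of the dual problem. -/
def dualSol (A : X →L[ℝ] Y) (P : PointedCone ℝ X) (Q : PointedCone ℝ Y)
    (c : X →L[ℝ] ℝ) (b : Y) : Set (Y →L[ℝ] ℝ) :=
  {g | g ∈ dualFeasible A P Q c ∧ ∀ g' ∈ dualFeasible A P Q c, g' b ≤ g b}

/-- For some real `l`, the set of all `y` such that some `x ∈ P` satisfies `Ax - y ∈ Q` and
`⟨x, c⟩ ≤ l` is a neighborhood of `b` in `Y₀`. -/
def SublevelCondition (A : X →L[ℝ] Y) (P : PointedCone ℝ X) (Q : PointedCone ℝ Y)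
    (c : X →L[ℝ] ℝ) (b : Y) : Prop :=
  ∃ (l : ℝ) (hb : b ∈ Y₀ A P Q),
    (fun y : Y₀ A P Q => (y : Y)) ⁻¹' {y : Y | ∃ x ∈ P, A x - y ∈ Q ∧ c x ≤ l}
      ∈ 𝓝 (⟨b, hb⟩ : Y₀ A P Q)

/-- Some `x₀ ∈ P` satisfies `Ax₀ - b ∈ int_{Y₀} Q`. -/
def SlaterCondition (A : X →L[ℝ] Y) (P : PointedCone ℝ X) (Q : PointedCone ℝ Y)
    (b : Y) : Prop :=
  ∃ x₀ ∈ P, A x₀ - b ∈ interiorIn (Y₀ A P Q) (Q : Set Y)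

/-- `h_c = -∞` on `icr (A(P) - Q)`. -/
def AlternativeA (A : X →L[ℝ] Y) (P : PointedCone ℝ X) (Q : PointedCone ℝ Y)
    (c : X →L[ℝ] ℝ) : Prop :=
  ∀ y ∈ icr (imageDiff A P Q), valueFun A P Q c y = ⊥

/-- `c ∈ P⁺ + A*(Q⁺)`, and the restriction of `h_c` to `Y₀` is continuous at `b`. -/
def AlternativeB (A : X →L[ℝ] Y) (P : PointedCone ℝ X) (Q : PointedCone ℝ Y)
    (c : X →L[ℝ] ℝ) (b : Y) : Prop :=
  c ∈ posDual (P : Set X) + adj A '' posDual (Q : Set Y) ∧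
    ∃ hb : b ∈ Y₀ A P Q,
      ContinuousAt (fun y : Y₀ A P Q => valueFun A P Q c (y : Y)) ⟨b, hb⟩

end Problem

end ConicLP

open ConicLP

/-! ### Absorbing convex sets and neighborhoods of the origin -/

section ConvexNeighborhoods

open Filter Set

variable {E : Type*} [AddCommGroup E] [Module ℝ E]

/-! All four hypotheses reduce to (i). Under Slater's condition one fixed point stays feasible for
all right-hand sides near `b`. In the other two cases the intrinsic core makes a translated relation
absorbing: in finite dimension an absorbing convex set is a neighborhood of `0`, and in Fréchet
spaces the Robinson–Ursescu theorem applies.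

Under (i), if `h_c(b) = r` is real, the epigraph-type cone of pairs (right-hand side, bound on the
cost) in `Y₀ × ℝ` has interior, and `(b, r)` lies outside that interior. Hahn–Banach separation
gives a non-vertical functional, which extends to `Y` as a dual feasible `g` with `g b ≥ r`
(`exists_dualFeasible_ge`). By weak duality `g ≤ h_c` everywhere, so equality holds at `b`. Hence
`g` is a dual solution and a subgradient, and it yields lower semicontinuity; convexity and (i)
yield upper semicontinuity.

If `h_c(b) = -∞`, convexity spreads this value over the whole intrinsic core. Compactness of the
solution set is Banach–Alaoglu with the bound that (i) provides. -/

theorem Convex.sum_smul_mem_of_sum_le_one {ι : Type*} {S : Set E} (hS : Convex ℝ S)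
    (h0 : (0 : E) ∈ S) {s : Finset ι} {w : ι → ℝ} {p : ι → E} (hw : ∀ i ∈ s, 0 ≤ w i)
    (hw1 : ∑ i ∈ s, w i ≤ 1) (hp : ∀ i ∈ s, p i ∈ S) : ∑ i ∈ s, w i • p i ∈ S := by
  rcases (Finset.sum_nonneg hw).eq_or_lt with h | h
  · rw [Finset.sum_eq_zero]
    · exact h0
    · intro i hi
      rw [(Finset.sum_eq_zero_iff_of_nonneg hw).1 h.symm i hi, zero_smul]
  · have hc := hS.centerMass_mem hw h hp
    have := hS.smul_mem_of_zero_mem h0 hc ⟨h.le, hw1⟩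
    rwa [Finset.centerMass, smul_smul, mul_inv_cancel₀ h.ne', one_smul] at this

variable [TopologicalSpace E] [IsTopologicalAddGroup E] [ContinuousSMul ℝ E]

/-- Each coordinate term of `z` is a nonnegative multiple of a point of `S` on the ray of plus or
minus the basis vector. The total weight is at most `N z`, which is continuous and vanishes at `0`.
-/
theorem Convex.mem_nhds_zero_of_absorbing_of_finiteDimensional [T2Space E]
    [FiniteDimensional ℝ E] {S : Set E} (hS : Convex ℝ S)
    (habs : ∀ v : E, ∃ δ : ℝ, 0 < δ ∧ δ • v ∈ S) : S ∈ 𝓝 (0 : E) := by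
  have h0 : (0 : E) ∈ S := by
    obtain ⟨δ, -, h⟩ := habs 0
    simpa using h
  let B := Module.finBasis ℝ E
  choose δ hδ hδS using habs
  let N : E → ℝ := fun z => ∑ i, (|B.repr z i| / δ (B i) + |B.repr z i| / δ (-B i))
  have hN : Continuous N := by
    refine continuous_finsetSum _ fun i _ => ?_
    have : Continuous fun z => B.repr z i :=
      LinearMap.continuous_of_finiteDimensional (B.coord i)
    fun_prop
  have hev : ∀ᶠ z in 𝓝 (0 : E), N z < 1 :=
    hN.continuousAt.eventually_lt continuousAt_const (by simp [N])
  filter_upwards [hev] with z hz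
  have key : ∀ i, ∃ w : ℝ, ∃ p ∈ S, 0 ≤ w ∧
      w ≤ |B.repr z i| / δ (B i) + |B.repr z i| / δ (-B i) ∧ w • p = B.repr z i • B i := by
    intro i
    have h1 := hδ (B i)
    have h2 := hδ (-B i)
    rcases le_total 0 (B.repr z i) with h | h
    · refine ⟨B.repr z i / δ (B i), _, hδS (B i), by positivity, ?_, ?_⟩
      · rw [abs_of_nonneg h]
        have : 0 ≤ B.repr z i / δ (-B i) := by positivity
        linarith
      · rw [smul_smul, div_mul_cancel₀ _ h1.ne']
    · refine ⟨-B.repr z i / δ (-B i), _, hδS (-B i),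
        div_nonneg (neg_nonneg.2 h) h2.le, ?_, ?_⟩
      · rw [abs_of_nonpos h]
        have : 0 ≤ -B.repr z i / δ (B i) := div_nonneg (neg_nonneg.2 h) h1.le
        linarith
      · rw [smul_smul, div_mul_cancel₀ _ h2.ne']
        simp
  choose w p hp hw hwle hwp using key
  rw [← B.sum_repr z]
  simp_rw [← hwp]
  exact hS.sum_smul_mem_of_sum_le_one h0 (fun i _ => hw i)
    ((Finset.sum_le_sum fun i _ => hwle i).trans hz.le) fun i _ => hp i

/-- The symmetrized closure `C` is still absorbing, so its dilates cover the space and by Baire `C`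
has an interior point `u`. The midpoint of `u` and `-u ∈ C` is then interior too. -/
theorem Convex.closure_mem_nhds_zero_of_absorbing [BaireSpace E] {S : Set E}
    (hS : Convex ℝ S) (habs : ∀ v : E, ∃ δ : ℝ, 0 < δ ∧ δ • v ∈ S) :
    closure S ∈ 𝓝 (0 : E) := by
  have h0 : (0 : E) ∈ S := by
    obtain ⟨δ, -, h⟩ := habs 0
    simpa using h
  let C := closure S ∩ -closure S
  have hCc : Convex ℝ C := hS.closure.inter hS.closure.neg
  have hCcl : IsClosed C := isClosed_closure.inter isClosed_closure.neg
  have hC0 : (0 : E) ∈ C := ⟨subset_closure h0, by simpa using subset_closure h0⟩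
  have hcov : (⋃ n : ℕ, (fun x : E => ((n : ℝ) + 1)⁻¹ • x) ⁻¹' C) = univ := by
    refine eq_univ_of_forall fun v => mem_iUnion.2 ?_
    obtain ⟨δ, hδ, hv⟩ := habs v
    obtain ⟨δ', hδ', hv'⟩ := habs (-v)
    obtain ⟨n, hn⟩ := exists_nat_ge (max δ⁻¹ δ'⁻¹)
    have hpos : (0 : ℝ) < (n : ℝ) + 1 := by positivity
    have aux : ∀ {d : ℝ} {u : E}, 0 < d → d⁻¹ ≤ n → d • u ∈ S →
        ((n : ℝ) + 1)⁻¹ • u ∈ closure S := by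
      intro d u hd hdn hu
      have := hS.smul_mem_of_zero_mem h0 hu (t := ((n : ℝ) + 1)⁻¹ * d⁻¹)
        ⟨by positivity, by
          rw [inv_mul_le_iff₀ hpos]
          linarith⟩
      rw [smul_smul, mul_assoc, inv_mul_cancel₀ hd.ne', mul_one] at this
      exact subset_closure this
    refine ⟨n, aux hδ (le_trans (le_max_left _ _) hn) hv, ?_⟩
    have := aux hδ' (le_trans (le_max_right _ _) hn) hv'
    rw [smul_neg] at this
    simpa using this
  obtain ⟨n, x, hx⟩ := nonempty_interior_of_iUnion_of_closed
    (fun n : ℕ => hCcl.preimage (continuous_const_smul (((n : ℝ) + 1)⁻¹))) hcov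
  have hpos : (0 : ℝ) < (n : ℝ) + 1 := by positivity
  have hu : ((n : ℝ) + 1)⁻¹ • x ∈ interior C := by
    rw [mem_interior_iff_mem_nhds] at hx ⊢
    have hc : Tendsto (fun z : E => ((n : ℝ) + 1) • z) (𝓝 (((n : ℝ) + 1)⁻¹ • x)) (𝓝 x) := by
      have := (continuous_const_smul ((n : ℝ) + 1)).tendsto (((n : ℝ) + 1)⁻¹ • x)
      rwa [smul_inv_smul₀ hpos.ne'] at this
    filter_upwards [hc hx] with z hz
    simpa [inv_smul_smul₀ hpos.ne'] using hz
  have hnu : -(((n : ℝ) + 1)⁻¹ • x) ∈ C := by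
    have := interior_subset hu
    exact ⟨this.2, by simpa using this.1⟩
  have hmid := hCc.combo_interior_self_mem_interior hu hnu (a := 1 / 2) (b := 1 / 2)
    (by norm_num) (by norm_num) (by norm_num)
  rw [smul_neg, add_neg_cancel] at hmid
  exact mem_of_superset (mem_interior_iff_mem_nhds.1 hmid) inter_subset_left

theorem exists_antitone_closed_convex_nhds_zero [LocallyConvexSpace ℝ E]
    [FirstCountableTopology E] {U : Set E} (hU : U ∈ 𝓝 (0 : E)) :
    ∃ V : ℕ → Set E, Antitone V ∧ V 0 ⊆ U ∧
      (∀ n, V n ∈ 𝓝 (0 : E) ∧ IsClosed (V n) ∧ Convex ℝ (V n)) ∧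
      ∀ N ∈ 𝓝 (0 : E), ∃ n, V n ⊆ N := by
  obtain ⟨B, hB⟩ := (𝓝 (0 : E)).exists_antitone_basis
  have key : ∀ n, ∃ C : Set E, C ∈ 𝓝 (0 : E) ∧ IsClosed C ∧ Convex ℝ C ∧ C ⊆ B n ∩ U := by
    intro n
    obtain ⟨T, hT, hTcl, hTs⟩ :=
      exists_mem_nhds_isClosed_subset (inter_mem (hB.1.mem_of_mem trivial : B n ∈ 𝓝 0) hU)
    obtain ⟨C, ⟨hC, hCc⟩, hCT⟩ :=
      ((LocallyConvexSpace.convex_basis_zero ℝ E).mem_iff).1 hT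
    exact ⟨closure C, mem_of_superset hC subset_closure, isClosed_closure, hCc.closure,
      (closure_minimal hCT hTcl).trans hTs⟩
  choose C hC hCcl hCc hCs using key
  refine ⟨fun n => ⋂ k ∈ Finset.range (n + 1), C k, ?_, ?_, fun n => ⟨?_, ?_, ?_⟩, ?_⟩
  · intro m n hmn
    exact biInter_subset_biInter_left fun k hk => by
      simp only [Finset.coe_range, mem_Iio] at hk ⊢
      omega
  · exact (biInter_subset_of_mem (by simp)).trans ((hCs 0).trans inter_subset_right)
  · exact (Filter.biInter_finset_mem _).2 fun k _ => hC k
  · exact isClosed_biInter fun k _ => hCcl k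
  · exact convex_iInter₂ fun k _ => hCc k
  · intro N hN
    obtain ⟨n, -, hn⟩ := hB.1.mem_iff.1 hN
    exact ⟨n, (biInter_subset_of_mem (by simp)).trans
      ((hCs n).trans (inter_subset_left.trans hn))⟩

end ConvexNeighborhoods

/-! ### Openness of closed convex relations (Robinson–Ursescu) -/

section ClosedConvexRelation

open Filter Set

variable {E F : Type*}
  [AddCommGroup E] [Module ℝ E] [UniformSpace E] [IsUniformAddGroup E] [ContinuousSMul ℝ E]
  [LocallyConvexSpace ℝ E] [FirstCountableTopology E] [CompleteSpace E]
  [AddCommGroup F] [Module ℝ F] [TopologicalSpace F] [IsTopologicalAddGroup F]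
  [ContinuousSMul ℝ F] [FirstCountableTopology F]

/-- A closed convex relation which is almost open at the origin is open at the origin. -/
theorem IsClosed.relation_image_mem_nhds_of_closure {G : Set (E × F)} (hGcl : IsClosed G)
    (hGc : Convex ℝ G) (hG0 : (0 : E × F) ∈ G)
    (hcl : ∀ U ∈ 𝓝 (0 : E), closure {z : F | ∃ x ∈ U, (x, z) ∈ G} ∈ 𝓝 (0 : F))
    {U : Set E} (hU : U ∈ 𝓝 (0 : E)) : {z : F | ∃ x ∈ U, (x, z) ∈ G} ∈ 𝓝 (0 : F) := by
  obtain ⟨V, hVanti, hVU, hV, hVbasis⟩ := exists_antitone_closed_convex_nhds_zero hU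
  obtain ⟨B, hB⟩ := (𝓝 (0 : F)).exists_antitone_basis
  let W : ℕ → Set F := fun n => closure {z : F | ∃ x ∈ V n, (x, z) ∈ G} ∩ B n
  have hW : ∀ n, W n ∈ 𝓝 (0 : F) := fun n =>
    inter_mem (hcl _ (hV n).1) (hB.1.mem_of_mem trivial)
  -- Successive approximation: a point of `W n` is matched by an element of `G` up to an error whose
  -- double lies in `W (n + 1)`. Keeping membership as a premise makes the choice total, so that `w`
  -- can be defined by plain recursion.
  have step : ∀ n : ℕ, ∀ w : F, ∃ p : E × F, w ∈ W n →
      p.1 ∈ V n ∧ p ∈ G ∧ (2 : ℝ) • (w - p.2) ∈ W (n + 1) := by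
    intro n w
    by_cases hw : w ∈ W n
    · have hc : Tendsto (fun y : F => (2 : ℝ) • (w - y)) (𝓝 w) (𝓝 0) := by
        have : Continuous fun y : F => (2 : ℝ) • (w - y) := by fun_prop
        simpa using this.tendsto w
      obtain ⟨y, hy, x, hx, hxy⟩ := mem_closure_iff_nhds.1 hw.1 _ (hc (hW (n + 1)))
      exact ⟨(x, y), fun _ => ⟨hx, hxy, hy⟩⟩
    · exact ⟨0, fun h => absurd h hw⟩
  choose p hp using step
  have half : Tendsto (fun z : F => (2 : ℝ) • z) (𝓝 0) (𝓝 0) := by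
    simpa using (continuous_const_smul (2 : ℝ)).tendsto (0 : F)
  filter_upwards [half (hW 0)] with z hz
  let w : ℕ → F := fun n =>
    Nat.rec (motive := fun _ => F) ((2 : ℝ) • z) (fun k v => (2 : ℝ) • (v - (p k v).2)) n
  have w_succ : ∀ n, w (n + 1) = (2 : ℝ) • (w n - (p n (w n)).2) := fun _ => rfl
  have hwW : ∀ n, w n ∈ W n := by
    intro n
    induction n with
    | zero => exact hz
    | succ n ih => exact (hp n (w n) ih).2.2
  let q : ℕ → E × F := fun n => p n (w n)
  have hqV : ∀ n, (q n).1 ∈ V n := fun n => (hp n _ (hwW n)).1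
  have hqG : ∀ n, q n ∈ G := fun n => (hp n _ (hwW n)).2.1
  -- The weights sum to `1`. Hence all partial sums of `a n • q n` stay in `G`, and their first
  -- components in `V 0`.
  let a : ℕ → ℝ := fun n => 1 / 2 / 2 ^ n
  have ha : ∀ n, 0 ≤ a n := fun n => by positivity
  have hasum : ∀ s : Finset ℕ, ∑ n ∈ s, a n ≤ 1 := fun s =>
    sum_le_hasSum s (fun n _ => ha n) (hasSum_geometric_two' 1)
  have hsummable : Summable fun n => a n • (q n).1 := by
    rw [summable_iff_vanishing]
    intro N hN
    obtain ⟨n, hn⟩ := hVbasis N hN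
    refine ⟨Finset.range n, fun t ht => hn ?_⟩
    refine (hV n).2.2.sum_smul_mem_of_sum_le_one (mem_of_mem_nhds (hV n).1)
      (fun i _ => ha i) (hasum t) fun i hi => hVanti ?_ (hqV i)
    by_contra hlt
    exact Finset.disjoint_left.1 ht hi (Finset.mem_range.2 (not_le.1 hlt))
  obtain ⟨x, hx⟩ := hsummable
  have hx' := hx.tendsto_sum_nat
  -- The doubling in the recursion cancels the halving of `a`; the start `w 0 = 2 • z` matches `a 0
  -- = 1/2`.
  have hrem : ∀ n, ∑ k ∈ Finset.range n, a k • (q k).2 = z - a n • w n := by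
    intro n
    induction n with
    | zero =>
      have : w 0 = (2 : ℝ) • z := rfl
      simp only [Finset.range_zero, Finset.sum_empty, this, a]
      module
    | succ n ih =>
      rw [Finset.sum_range_succ, ih, w_succ]
      have : a n = a (n + 1) * 2 := by
        simp only [a, pow_succ]
        field_simp
      rw [smul_smul, ← this, smul_sub]
      simp only [q]
      abel
  have hw0 : Tendsto w atTop (𝓝 0) := by
    rw [hB.1.tendsto_right_iff]
    intro n _
    filter_upwards [eventually_ge_atTop n] with m hm
    exact hB.2 hm (hwW m).2
  have ha0 : Tendsto a atTop (𝓝 0) := by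
    have := (hasSum_geometric_two' 1).summable.tendsto_atTop_zero
    exact this
  have hz' : Tendsto (fun n => ∑ k ∈ Finset.range n, a k • (q k).2) atTop (𝓝 z) := by
    simp_rw [hrem]
    simpa using tendsto_const_nhds.sub (ha0.smul hw0)
  refine ⟨x, hVU ((hV 0).2.1.mem_of_tendsto hx' (Eventually.of_forall fun n => ?_)), ?_⟩
  · exact (hV 0).2.2.sum_smul_mem_of_sum_le_one (mem_of_mem_nhds (hV 0).1)
      (fun i _ => ha i) (hasum _) fun i _ => hVanti (Nat.zero_le i) (hqV i)
  · refine hGcl.mem_of_tendsto (hx'.prodMk_nhds hz') (Eventually.of_forall fun n => ?_)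
    have := hGc.sum_smul_mem_of_sum_le_one hG0 (s := Finset.range n)
      (fun i _ => ha i) (hasum _) fun i _ => hqG i
    convert this using 1
    ext <;> simp [Prod.fst_sum, Prod.snd_sum]

/-- The Robinson–Ursescu theorem at the origin: a closed convex relation from a Fréchet space to
a Baire space whose range is absorbing is open at the origin. -/
theorem IsClosed.relation_image_mem_nhds [BaireSpace F] {G : Set (E × F)} (hGcl : IsClosed G)
    (hGc : Convex ℝ G) (hG0 : (0 : E × F) ∈ G)
    (habs : ∀ z : F, ∃ δ : ℝ, 0 < δ ∧ ∃ x : E, (x, δ • z) ∈ G)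
    {U : Set E} (hU : U ∈ 𝓝 (0 : E)) : {z : F | ∃ x ∈ U, (x, z) ∈ G} ∈ 𝓝 (0 : F) := by
  refine hGcl.relation_image_mem_nhds_of_closure hGc hG0 (fun N hN => ?_) hU
  obtain ⟨C, ⟨hC, hCc⟩, hCN⟩ := ((LocallyConvexSpace.convex_basis_zero ℝ E).mem_iff).1 hN
  have hconv : Convex ℝ {z : F | ∃ x ∈ C, (x, z) ∈ G} := by
    rintro z ⟨x, hx, hxz⟩ z' ⟨x', hx', hxz'⟩ s t hs ht hst
    exact ⟨s • x + t • x', hCc hx hx' hs ht hst, hGc hxz hxz' hs ht hst⟩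
  refine mem_of_superset (hconv.closure_mem_nhds_zero_of_absorbing fun z => ?_)
    (closure_mono fun z ⟨x, hx, hxz⟩ => ⟨x, hCN hx, hxz⟩)
  obtain ⟨δ, hδ, x, hx⟩ := habs z
  have hev : ∀ᶠ t : ℝ in 𝓝[>] 0, t • x ∈ C ∧ t < 1 ∧ 0 < t := by
    have hc : Tendsto (fun t : ℝ => t • x) (𝓝[>] 0) (𝓝 0) := by
      have : Continuous fun t : ℝ => t • x := by fun_prop
      simpa using (this.tendsto 0).mono_left nhdsWithin_le_nhds
    filter_upwards [hc hC, nhdsWithin_le_nhds (gt_mem_nhds one_pos), self_mem_nhdsWithin]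
      with t h1 h2 h3 using ⟨h1, h2, h3⟩
  obtain ⟨t, htx, ht1, ht0⟩ := hev.exists
  refine ⟨t * δ, by positivity, t • x, htx, ?_⟩
  rw [mul_smul]
  exact hGc.smul_mem_of_zero_mem hG0 hx ⟨ht0.le, ht1.le⟩

end ClosedConvexRelation

/-! ### Weak-star compactness -/

section WeakDualCompact

open Filter Set

variable {E : Type*} [AddCommGroup E] [Module ℝ E] [TopologicalSpace E]
  [IsTopologicalAddGroup E] [ContinuousSMul ℝ E]

/-- The Banach–Alaoglu theorem in a topological vector space. -/
theorem WeakDual.isCompact_setOf_abs_le {W : Set E} (hW : W ∈ 𝓝 (0 : E)) (M : ℝ) :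
    IsCompact {g : WeakDual ℝ E | ∀ x ∈ W, |g x| ≤ M} := by
  have habs : ∀ x : E, ∃ t : ℝ, 0 < t ∧ t • x ∈ W := by
    intro x
    have hc : Tendsto (fun t : ℝ => t • x) (𝓝[>] 0) (𝓝 0) := by
      have : Continuous fun t : ℝ => t • x := by fun_prop
      simpa using (this.tendsto 0).mono_left nhdsWithin_le_nhds
    obtain ⟨t, ht, ht0⟩ := Filter.nonempty_of_mem (inter_mem (Filter.mem_map.1 (hc hW)) self_mem_nhdsWithin)
    exact ⟨t, ht0, ht⟩
  choose t ht htW using habs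
  have hemb : Topology.IsEmbedding ((↑) : WeakDual ℝ E → E → ℝ) :=
    DFunLike.coe_injective.isEmbedding_induced
  rw [hemb.isCompact_iff]
  have himage : ((↑) : WeakDual ℝ E → E → ℝ) '' {g : WeakDual ℝ E | ∀ x ∈ W, |g x| ≤ M} =
      Set.range ((↑) : (E →ₗ[ℝ] ℝ) → E → ℝ) ∩ {f | ∀ x ∈ W, |f x| ≤ M} := by
    ext f
    constructor
    · rintro ⟨g, hg, rfl⟩
      exact ⟨⟨(WeakDual.toStrongDual g : E →L[ℝ] ℝ).toLinearMap, rfl⟩, hg⟩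
    · rintro ⟨⟨g, rfl⟩, hg⟩
      have hM : 0 ≤ M := (abs_nonneg _).trans (hg 0 (mem_of_mem_nhds hW))
      -- A linear functional bounded on a neighborhood of `0` is continuous, so pointwise limits do
      -- not leave the dual.
      have hcont : Continuous ((normSeminorm ℝ ℝ).comp g) := by
        refine Seminorm.continuous' (r := M) (mem_of_superset hW fun x hx => ?_)
        simpa [Seminorm.mem_closedBall] using hg x hx
      have hg' : Continuous g := by
        refine continuous_of_continuousAt_zero g ?_
        have := hcont.tendsto 0
        rw [ContinuousAt, map_zero, tendsto_zero_iff_norm_tendsto_zero]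
        rw [map_zero] at this
        exact this
      exact ⟨StrongDual.toWeakDual ⟨g, hg'⟩, hg, rfl⟩
  rw [himage]
  have hclosed : IsClosed (Set.range ((↑) : (E →ₗ[ℝ] ℝ) → E → ℝ) ∩
      {f | ∀ x ∈ W, |f x| ≤ M}) := by
    refine (LinearMap.isClosed_range_coe E ℝ (RingHom.id ℝ)).inter ?_
    simp only [ofPred_forall]
    exact isClosed_biInter fun x _ =>
      isClosed_le ((continuous_apply x).abs) continuous_const
  refine (isCompact_univ_pi fun x =>
    isCompact_Icc (a := -(M / t x)) (b := M / t x)).of_isClosed_subset hclosed ?_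
  rintro _ ⟨⟨g, rfl⟩, hg⟩ x -
  have := hg _ (htW x)
  rw [map_smul, smul_eq_mul, abs_mul, abs_of_pos (ht x)] at this
  rw [mem_Icc, ← abs_le, le_div_iff₀ (ht x), mul_comm]
  exact this

end WeakDualCompact

namespace ConicLP

open Filter Set

theorem combo_mem {V : Type*} [AddCommGroup V] [Module ℝ V] {K : PointedCone ℝ V} {x x' : V}
    {s t : ℝ} (hs : 0 ≤ s) (ht : 0 ≤ t) (h : x ∈ K) (h' : x' ∈ K) : s • x + t • x' ∈ K :=
  K.add_mem (PointedCone.smul_mem K hs h) (PointedCone.smul_mem K ht h')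

/-! ### Value function, weak duality and convexity -/

section Problem

variable {X Y : Type*}
  [AddCommGroup X] [Module ℝ X] [TopologicalSpace X]
  [AddCommGroup Y] [Module ℝ Y] [TopologicalSpace Y]
  {A : X →L[ℝ] Y} {P : PointedCone ℝ X} {Q : PointedCone ℝ Y} {c : X →L[ℝ] ℝ} {b : Y}

/-- The right-hand sides `y` for which the primal problem has a feasible point of cost at
most `l`. -/
def costSublevel (A : X →L[ℝ] Y) (P : PointedCone ℝ X) (Q : PointedCone ℝ Y)
    (c : X →L[ℝ] ℝ) (l : ℝ) : Set Y :=
  {y | ∃ x ∈ P, A x - y ∈ Q ∧ c x ≤ l}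

theorem mem_imageDiff {y : Y} : y ∈ imageDiff A P Q ↔ ∃ x ∈ P, A x - y ∈ Q := by
  constructor
  · rintro ⟨_, ⟨x, hx, rfl⟩, q, hq, rfl⟩
    exact ⟨x, hx, by simpa using hq⟩
  · rintro ⟨x, hx, hq⟩
    exact ⟨_, ⟨x, hx, rfl⟩, _, hq, by simp⟩

theorem imageDiff_subset : imageDiff A P Q ⊆ Y₀ A P Q :=
  Submodule.subset_span

theorem map_mem_Y₀ {x : X} (hx : x ∈ P) : A x ∈ Y₀ A P Q :=
  imageDiff_subset (mem_imageDiff.2 ⟨x, hx, by simp⟩)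

theorem coe_affineSpan_imageDiff :
    (affineSpan ℝ (imageDiff A P Q) : Set Y) = Y₀ A P Q := by
  have h0 : (0 : Y) ∈ imageDiff A P Q := mem_imageDiff.2 ⟨0, P.zero_mem, by simp⟩
  rw [← insert_eq_of_mem h0, affineSpan_insert_zero]
  rfl

theorem costSublevel_subset_imageDiff {l : ℝ} : costSublevel A P Q c l ⊆ imageDiff A P Q :=
  fun _ ⟨x, hx, hq, _⟩ => mem_imageDiff.2 ⟨x, hx, hq⟩

theorem mem_costSublevel_of_preimage_mem_nhds {l : ℝ} {hb : b ∈ Y₀ A P Q}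
    (hn : (fun y : Y₀ A P Q => (y : Y)) ⁻¹' costSublevel A P Q c l ∈ 𝓝 ⟨b, hb⟩) :
    b ∈ costSublevel A P Q c l :=
  mem_of_mem_nhds (s := (fun y : Y₀ A P Q => (y : Y)) ⁻¹' costSublevel A P Q c l) hn

theorem combo_sub_mem {x x' : X} {y y' : Y} {s t : ℝ} (hs : 0 ≤ s) (ht : 0 ≤ t)
    (h : A x - y ∈ Q) (h' : A x' - y' ∈ Q) :
    A (s • x + t • x') - (s • y + t • y') ∈ Q := by
  have : A (s • x + t • x') - (s • y + t • y') = s • (A x - y) + t • (A x' - y') := by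
    simp only [map_add, map_smul]
    module
  rw [this]
  exact combo_mem hs ht h h'

theorem convex_costSublevel (l : ℝ) : Convex ℝ (costSublevel A P Q c l) := by
  rintro y ⟨x, hx, hxy, hxl⟩ y' ⟨x', hx', hxy', hxl'⟩ s t hs ht hst
  refine ⟨_, combo_mem hs ht hx hx', combo_sub_mem hs ht hxy hxy', ?_⟩
  simp only [map_add, map_smul, smul_eq_mul]
  calc s * c x + t * c x' ≤ s * l + t * l := by gcongr
    _ = l := by rw [← add_mul, hst, one_mul]

theorem perturbation_of_feasible {x : X} {y : Y} (hx : x ∈ P) (hq : A x - y ∈ Q) :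
    perturbation A P Q c x y = (c x : ℝ) := by
  simp [perturbation, ind, hx, hq]

theorem perturbation_of_not_feasible {x : X} {y : Y} (h : ¬(x ∈ P ∧ A x - y ∈ Q)) :
    perturbation A P Q c x y = ⊤ := by
  by_cases hx : x ∈ P
  · have hq : A x - y ∉ Q := fun hq => h ⟨hx, hq⟩
    simp [perturbation, ind, hx, hq]
  · by_cases hq : A x - y ∈ Q <;> simp [perturbation, ind, hx, hq]

theorem valueFun_eq_primalVal (y : Y) : valueFun A P Q c y = primalVal A P Q c y := by
  refine iInf_congr fun x => ?_
  by_cases h : x ∈ P ∧ A x - y ∈ Q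
  · have hx : x ∈ primalFeasible A P Q y := h
    rw [perturbation_of_feasible h.1 h.2, iInf_pos hx]
  · exact (perturbation_of_not_feasible h).trans
      (iInf_neg (show x ∉ primalFeasible A P Q y from h)).symm

theorem valueFun_le {x : X} {y : Y} (hx : x ∈ P) (hq : A x - y ∈ Q) :
    valueFun A P Q c y ≤ (c x : ℝ) :=
  (iInf_le _ x).trans (perturbation_of_feasible hx hq).le

theorem valueFun_le_of_mem_costSublevel {l : ℝ} {y : Y} (hy : y ∈ costSublevel A P Q c l) :
    valueFun A P Q c y ≤ l := by
  obtain ⟨x, hx, hq, hl⟩ := hy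
  exact (valueFun_le hx hq).trans (EReal.coe_le_coe_iff.2 hl)

theorem exists_of_valueFun_lt {y : Y} {t : ℝ} (h : valueFun A P Q c y < t) :
    ∃ x ∈ P, A x - y ∈ Q ∧ c x < t := by
  obtain ⟨x, hx⟩ := iInf_lt_iff.1 h
  by_cases hf : x ∈ P ∧ A x - y ∈ Q
  · rw [perturbation_of_feasible hf.1 hf.2] at hx
    exact ⟨x, hf.1, hf.2, EReal.coe_lt_coe_iff.1 hx⟩
  · rw [perturbation_of_not_feasible hf] at hx
    exact absurd hx not_top_lt

theorem mem_dualFeasible {g : Y →L[ℝ] ℝ} : g ∈ dualFeasible A P Q c ↔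
    (∀ q ∈ Q, 0 ≤ g q) ∧ ∀ x ∈ P, g (A x) ≤ c x := by
  simp [dualFeasible, posDual, adj]

theorem le_valueFun {g : Y →L[ℝ] ℝ} (hg : g ∈ dualFeasible A P Q c) (y : Y) :
    ((g y : ℝ) : EReal) ≤ valueFun A P Q c y := by
  rw [mem_dualFeasible] at hg
  refine le_iInf fun x => ?_
  by_cases hf : x ∈ P ∧ A x - y ∈ Q
  · rw [perturbation_of_feasible hf.1 hf.2, EReal.coe_le_coe_iff]
    have h1 := hg.1 _ hf.2
    have h2 := hg.2 _ hf.1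
    rw [map_sub] at h1
    linarith
  · rw [perturbation_of_not_feasible hf]
    exact le_top

theorem dualVal_le_primalVal : dualVal A P Q c b ≤ primalVal A P Q c b := by
  rw [← valueFun_eq_primalVal]
  exact iSup₂_le fun g hg => le_valueFun hg b

theorem dualFeasible_nonempty
    (hc : c ∈ posDual (P : Set X) + adj A '' posDual (Q : Set Y)) :
    (dualFeasible A P Q c).Nonempty := by
  obtain ⟨p, hp, _, ⟨g, hg, rfl⟩, rfl⟩ := hc
  refine ⟨g, mem_dualFeasible.2 ⟨hg, fun x hx => ?_⟩⟩
  have := hp x hx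
  simpa [adj] using this

theorem mem_posDual_add_of_dualFeasible {g : Y →L[ℝ] ℝ} (hg : g ∈ dualFeasible A P Q c) :
    c ∈ posDual (P : Set X) + adj A '' posDual (Q : Set Y) :=
  ⟨c - adj A g, by simpa using hg.2, _, ⟨g, hg.1, rfl⟩, by simp⟩

/-- Moving from `y` slightly away from `b` stays in `A(P) - Q`. Thus `y` lies strictly between `b`,
where costs are unbounded below, and a point with a feasible solution. -/
theorem valueFun_eq_bot_of_mem_icr (hb : valueFun A P Q c b = ⊥) {y : Y}
    (hy : y ∈ icr (imageDiff A P Q)) : valueFun A P Q c y = ⊥ := by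
  obtain ⟨x₀, hx₀, hq₀, -⟩ := exists_of_valueFun_lt
    (show valueFun A P Q c b < (0 : ℝ) from hb ▸ EReal.bot_lt_coe 0)
  obtain ⟨δ, hδ, h⟩ := hy.2 b
    (subset_affineSpan ℝ _ (mem_imageDiff.2 ⟨x₀, hx₀, hq₀⟩))
  obtain ⟨x₁, hx₁, hq₁⟩ := mem_imageDiff.1 (h (-δ) (by rw [abs_neg, abs_of_pos hδ]))
  rw [EReal.eq_bot_iff_forall_lt]
  intro t
  obtain ⟨x₂, hx₂, hq₂, hlt⟩ := exists_of_valueFun_lt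
    (show valueFun A P Q c b < (((t * (1 + δ) - c x₁) / δ : ℝ)) from hb ▸ EReal.bot_lt_coe _)
  have hpos : 0 < 1 + δ := by linarith
  have hs : 0 ≤ (1 + δ)⁻¹ := by positivity
  have ht : 0 ≤ (1 + δ)⁻¹ * δ := by positivity
  have hq := combo_sub_mem hs ht hq₁ hq₂
  have hyeq : (1 + δ)⁻¹ • ((1 - -δ) • y + -δ • b) + ((1 + δ)⁻¹ * δ) • b = y := by
    rw [smul_add, smul_smul, smul_smul, sub_neg_eq_add, inv_mul_cancel₀ hpos.ne']
    module
  rw [hyeq] at hq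
  refine (valueFun_le (combo_mem hs ht hx₁ hx₂) hq).trans_lt (EReal.coe_lt_coe_iff.2 ?_)
  rw [lt_div_iff₀ hδ] at hlt
  simp only [map_add, map_smul, smul_eq_mul]
  rw [mul_assoc, ← mul_add, inv_mul_lt_iff₀ hpos]
  linarith

theorem exists_feasible_of_mem_icr (hb : b ∈ icr (imageDiff A P Q)) (z : Y₀ A P Q) :
    ∃ δ : ℝ, 0 < δ ∧ ∃ x ∈ P, A x - (b + δ • (z : Y)) ∈ Q := by
  have hz : b + (z : Y) ∈ affineSpan ℝ (imageDiff A P Q) := by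
    rw [← SetLike.mem_coe, coe_affineSpan_imageDiff]
    exact (Y₀ A P Q).add_mem (imageDiff_subset hb.1) z.2
  obtain ⟨δ, hδ, h⟩ := hb.2 _ hz
  obtain ⟨x, hx, hq⟩ := mem_imageDiff.1 (h δ (abs_of_pos hδ).le)
  refine ⟨δ, hδ, x, hx, ?_⟩
  convert hq using 2
  module

end Problem

/-! ### Neighborhood conditions, strong duality and continuity -/

section Topological

variable {X Y : Type*}
  [AddCommGroup X] [Module ℝ X] [TopologicalSpace X]
  [AddCommGroup Y] [Module ℝ Y] [TopologicalSpace Y] [IsTopologicalAddGroup Y]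
  [ContinuousSMul ℝ Y]
  {A : X →L[ℝ] Y} {P : PointedCone ℝ X} {Q : PointedCone ℝ Y} {c : X →L[ℝ] ℝ} {b : Y}

theorem SublevelCondition.mem_icr (h : SublevelCondition A P Q c b) :
    b ∈ icr (imageDiff A P Q) := by
  obtain ⟨l, hb, hn⟩ := h
  refine ⟨costSublevel_subset_imageDiff (mem_costSublevel_of_preimage_mem_nhds hn), fun x hx => ?_⟩
  have hx' : x ∈ Y₀ A P Q := affineSpan_subset_span hx
  have hc : Tendsto (fun s : ℝ => (1 - s) • (⟨b, hb⟩ : Y₀ A P Q) + s • ⟨x, hx'⟩) (𝓝 0)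
      (𝓝 ⟨b, hb⟩) := by
    have : Continuous fun s : ℝ => (1 - s) • (⟨b, hb⟩ : Y₀ A P Q) + s • ⟨x, hx'⟩ := by fun_prop
    simpa using this.tendsto 0
  obtain ⟨ε, hε, hball⟩ := Metric.mem_nhds_iff.1 (hc hn)
  refine ⟨ε / 2, by positivity, fun s hs => ?_⟩
  have hmem : s ∈ Metric.ball (0 : ℝ) ε := by
    rw [mem_ball_zero_iff, Real.norm_eq_abs]
    linarith
  exact costSublevel_subset_imageDiff (hball hmem)

omit [ContinuousSMul ℝ Y] in
theorem SlaterCondition.sublevelCondition (h : SlaterCondition A P Q b) :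
    SublevelCondition A P Q c b := by
  obtain ⟨x₀, hx₀, u, hu, hux⟩ := h
  have hux' : (u : Y) = A x₀ - b := hux
  have hb : b ∈ Y₀ A P Q := by
    have := (Y₀ A P Q).sub_mem (map_mem_Y₀ (A := A) (Q := Q) hx₀) u.2
    rwa [hux', sub_sub_cancel] at this
  refine ⟨c x₀, hb, ?_⟩
  have hc : Tendsto (fun y : Y₀ A P Q => (⟨A x₀, map_mem_Y₀ hx₀⟩ : Y₀ A P Q) - y)
      (𝓝 ⟨b, hb⟩) (𝓝 u) := by
    have : Continuous fun y : Y₀ A P Q => (⟨A x₀, map_mem_Y₀ hx₀⟩ : Y₀ A P Q) - y := by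
      fun_prop
    convert this.tendsto ⟨b, hb⟩ using 2
    exact Subtype.ext hux'
  filter_upwards [hc (mem_interior_iff_mem_nhds.1 hu)] with y hy
  exact ⟨x₀, hx₀, hy, le_rfl⟩

omit [ContinuousSMul ℝ Y] in
theorem SublevelCondition.of_nhds_zero {l : ℝ} (hb : b ∈ Y₀ A P Q)
    (h : {z : Y₀ A P Q | b + (z : Y) ∈ costSublevel A P Q c l} ∈ 𝓝 (0 : Y₀ A P Q)) :
    SublevelCondition A P Q c b := by
  refine ⟨l, hb, ?_⟩
  have hc : Tendsto (fun y : Y₀ A P Q => y - ⟨b, hb⟩) (𝓝 ⟨b, hb⟩) (𝓝 0) := by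
    have : Continuous fun y : Y₀ A P Q => y - ⟨b, hb⟩ := by fun_prop
    simpa using this.tendsto ⟨b, hb⟩
  filter_upwards [hc h] with y hy
  have : b + ((y - ⟨b, hb⟩ : Y₀ A P Q) : Y) ∈ costSublevel A P Q c l := hy
  rwa [show b + ((y - ⟨b, hb⟩ : Y₀ A P Q) : Y) = y by simp] at this

theorem SublevelCondition.of_finiteDimensional [T2Space Y] [FiniteDimensional ℝ (Y₀ A P Q)]
    (hb : b ∈ icr (imageDiff A P Q)) : SublevelCondition A P Q c b := by
  obtain ⟨x₀, hx₀, hq₀⟩ := mem_imageDiff.1 hb.1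
  refine .of_nhds_zero (l := c x₀ + 1) (imageDiff_subset hb.1) ?_
  refine Convex.mem_nhds_zero_of_absorbing_of_finiteDimensional ?_ fun v => ?_
  · intro z hz z' hz' s t hs ht hst
    have := convex_costSublevel (c x₀ + 1) hz hz' hs ht hst
    change b + ((s • z + t • z' : Y₀ A P Q) : Y) ∈ costSublevel A P Q c (c x₀ + 1)
    convert this using 1
    obtain rfl : s = 1 - t := by linarith
    simp only [Submodule.coe_add, Submodule.coe_smul]
    module
  · obtain ⟨δ, hδ, x, hx, hq⟩ := exists_feasible_of_mem_icr hb v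
    have hev : ∀ᶠ t : ℝ in 𝓝[>] 0, (1 - t) * c x₀ + t * c x < c x₀ + 1 ∧ t < 1 ∧ 0 < t := by
      have hc : Continuous fun t : ℝ => (1 - t) * c x₀ + t * c x := by fun_prop
      have : ∀ᶠ t : ℝ in 𝓝 0, (1 - t) * c x₀ + t * c x < c x₀ + 1 :=
        hc.continuousAt.eventually_lt continuousAt_const (by simp)
      filter_upwards [nhdsWithin_le_nhds this, nhdsWithin_le_nhds (gt_mem_nhds one_pos),
        self_mem_nhdsWithin] with t h1 h2 h3 using ⟨h1, h2, h3⟩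
    obtain ⟨t, hlt, ht1, ht0⟩ := hev.exists
    refine ⟨t * δ, by positivity, (1 - t) • x₀ + t • x,
      combo_mem (by linarith) ht0.le hx₀ hx, ?_, ?_⟩
    · convert combo_sub_mem (by linarith : 0 ≤ 1 - t) ht0.le hq₀ hq using 2
      simp only [Submodule.coe_smul]
      module
    · simpa using hlt.le

theorem exists_dualFeasible_ge [LocallyConvexSpace ℝ Y] (h : SublevelCondition A P Q c b)
    {r : ℝ} (hr : valueFun A P Q c b = r) :
    ∃ g ∈ dualFeasible A P Q c, r ≤ g b := by
  obtain ⟨l, hb, hn⟩ := h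
  let b' : Y₀ A P Q := ⟨b, hb⟩
  let E : Set (Y₀ A P Q × ℝ) := {p | ∃ x ∈ P, A x - (p.1 : Y) ∈ Q ∧ c x ≤ p.2}
  have hEcombo : ∀ {p p' : Y₀ A P Q × ℝ} {s t : ℝ}, p ∈ E → p' ∈ E → 0 ≤ s → 0 ≤ t →
      s • p + t • p' ∈ E := by
    rintro p p' s t ⟨x, hx, hq, hl⟩ ⟨x', hx', hq', hl'⟩ hs ht
    refine ⟨_, combo_mem hs ht hx hx', combo_sub_mem hs ht hq hq', ?_⟩
    simp only [map_add, map_smul, smul_eq_mul, Prod.snd_add, Prod.smul_snd]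
    gcongr
  have hEconv : Convex ℝ E := fun p hp p' hp' s t hs ht _ => hEcombo hp hp' hs ht
  have hE0 : (0 : Y₀ A P Q × ℝ) ∈ E := ⟨0, P.zero_mem, by simp, by simp⟩
  have hEint : (b', l + 1) ∈ interior E := by
    rw [mem_interior_iff_mem_nhds]
    refine mem_of_superset (prod_mem_nhds hn (lt_mem_nhds (lt_add_one l))) ?_
    rintro ⟨y, t⟩ ⟨⟨x, hx, hq, hl⟩, ht⟩
    exact ⟨x, hx, hq, hl.trans (le_of_lt ht)⟩
  -- Otherwise some `(b', s)` with `s < r` would lie in `E`, contradicting that `r` is the infimum.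
  have hbr : (b', r) ∉ interior E := by
    intro hmem
    have hc : Tendsto (fun s : ℝ => (b', s)) (𝓝[<] r) (𝓝 (b', r)) := by
      have : Continuous fun s : ℝ => (b', s) := by fun_prop
      exact (this.tendsto r).mono_left nhdsWithin_le_nhds
    obtain ⟨s, ⟨x, hx, hq, hl⟩, hs⟩ := Filter.nonempty_of_mem
      (inter_mem (mem_map.1 (hc (mem_interior_iff_mem_nhds.1 hmem))) self_mem_nhdsWithin)
    have := hr ▸ valueFun_le (c := c) hx hq
    rw [EReal.coe_le_coe_iff] at this
    have hs' : s < r := hs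
    have hl' : c x ≤ s := hl
    linarith
  obtain ⟨f, hf⟩ := geometric_hahn_banach_open_point hEconv.interior isOpen_interior hbr
  have hfE : ∀ p ∈ E, f p ≤ f (b', r) := by
    intro p hp
    have hcl : IsClosed {p : Y₀ A P Q × ℝ | f p ≤ f (b', r)} :=
      isClosed_le f.continuous continuous_const
    refine closure_minimal (fun p hp => (hf p hp).le) hcl ?_
    rw [hEconv.closure_interior_eq_closure_of_nonempty_interior ⟨_, hEint⟩]
    exact subset_closure hp
  have hf0 : 0 ≤ f (b', r) := by simpa using hfE 0 hE0
  -- A functional bounded above on a cone is nonpositive there.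
  have hfE0 : ∀ p ∈ E, f p ≤ 0 := by
    intro p hp
    by_contra! hpos
    have := hfE _ (hEcombo (s := f (b', r) / f p + 1) (t := 0) hp hE0 (by positivity) le_rfl)
    rw [zero_smul, add_zero, map_smul, smul_eq_mul, add_mul, div_mul_cancel₀ _ hpos.ne'] at this
    linarith
  let φ : Y₀ A P Q →L[ℝ] ℝ := f.comp (ContinuousLinearMap.inl ℝ _ _)
  let σ : ℝ := f (0, 1)
  have hfφ : ∀ (y : Y₀ A P Q) (t : ℝ), f (y, t) = φ y + t * σ := by
    intro y t
    have : (y, t) = (y, (0 : ℝ)) + t • ((0 : Y₀ A P Q), (1 : ℝ)) := by simp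
    rw [this, map_add, map_smul]
    rfl
  -- The separating hyperplane is not vertical: the interior point `(b', l + 1)` lies above `(b',
  -- r)`, since `r ≤ l`.
  have hσ : σ < 0 := by
    have h1 := hf _ hEint
    have h2 := hr ▸ valueFun_le_of_mem_costSublevel (mem_costSublevel_of_preimage_mem_nhds hn)
    rw [EReal.coe_le_coe_iff] at h2
    rw [hfφ, hfφ] at h1
    nlinarith
  obtain ⟨g, hg⟩ := StrongDual.exists_extension (𝕜 := ℝ) (Y₀ A P Q) ((-σ)⁻¹ • φ)
  have hσ' : 0 < -σ := by linarith
  have hgφ : ∀ y : Y₀ A P Q, -σ * g y = φ y := by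
    intro y
    rw [hg y]
    simp [hσ.ne]
  refine ⟨g, mem_dualFeasible.2 ⟨fun q hq => ?_, fun x hx => ?_⟩, ?_⟩
  · have hq0 : -q ∈ Y₀ A P Q :=
      imageDiff_subset (mem_imageDiff.2 ⟨0, P.zero_mem, by simpa using hq⟩)
    have := hfE0 (⟨-q, hq0⟩, 0) ⟨0, P.zero_mem, by simpa using hq, by simp⟩
    rw [hfφ, ← hgφ, map_neg] at this
    nlinarith
  · have := hfE0 (⟨A x, map_mem_Y₀ hx⟩, c x) ⟨x, hx, by simp, le_rfl⟩
    rw [hfφ, ← hgφ] at this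
    simp only at this
    nlinarith
  · rw [hfφ, ← hgφ] at hf0
    simp only [b'] at hf0
    nlinarith

/-- From below, `h_c` dominates `g` with equality at `b`. From above, `y` near `b` is `(1 - s) b + s
y'` with `y'` in the sublevel neighborhood; a small `s` keeps the cost near that of an almost
optimal point for `b`. -/
theorem continuousAt_valueFun (hsub : SublevelCondition A P Q c b) {g : Y →L[ℝ] ℝ}
    (hg : g ∈ dualFeasible A P Q c) (hgb : valueFun A P Q c b = (g b : ℝ)) :
    ∃ hb : b ∈ Y₀ A P Q,
      ContinuousAt (fun y : Y₀ A P Q => valueFun A P Q c (y : Y)) ⟨b, hb⟩ := by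
  obtain ⟨l, hb, hn⟩ := hsub
  refine ⟨hb, tendsto_order.2 ⟨fun a ha => ?_, fun a ha => ?_⟩⟩
  · have hc : Continuous fun y : Y₀ A P Q => ((g y : ℝ) : EReal) :=
      continuous_coe_real_ereal.comp (g.continuous.comp continuous_subtype_val)
    have ha' : a < ((g b : ℝ) : EReal) := hgb ▸ ha
    filter_upwards [hc.continuousAt.eventually (lt_mem_nhds ha')] with y hy
    exact hy.trans_le (le_valueFun hg y)
  · obtain ⟨t, hbt, hta⟩ := EReal.lt_iff_exists_real_btwn.1 ha
    obtain ⟨x₁, hx₁, hq₁, hlt⟩ := exists_of_valueFun_lt hbt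
    have hev : ∀ᶠ s : ℝ in 𝓝[>] 0, (1 - s) * c x₁ + s * l < t ∧ s < 1 ∧ 0 < s := by
      have hc : Continuous fun s : ℝ => (1 - s) * c x₁ + s * l := by fun_prop
      have : ∀ᶠ s : ℝ in 𝓝 0, (1 - s) * c x₁ + s * l < t :=
        hc.continuousAt.eventually_lt continuousAt_const (by simpa using hlt)
      filter_upwards [nhdsWithin_le_nhds this, nhdsWithin_le_nhds (gt_mem_nhds one_pos),
        self_mem_nhdsWithin] with s h1 h2 h3 using ⟨h1, h2, h3⟩
    obtain ⟨s, hst, hs1, hs0⟩ := hev.exists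
    have hc : Tendsto (fun y : Y₀ A P Q => (⟨b, hb⟩ : Y₀ A P Q) + s⁻¹ • (y - ⟨b, hb⟩))
        (𝓝 ⟨b, hb⟩) (𝓝 ⟨b, hb⟩) := by
      have : Continuous fun y : Y₀ A P Q => (⟨b, hb⟩ : Y₀ A P Q) + s⁻¹ • (y - ⟨b, hb⟩) := by
        fun_prop
      simpa using this.tendsto ⟨b, hb⟩
    filter_upwards [hc hn] with y hy
    obtain ⟨x₂, hx₂, hq₂, hl₂⟩ := hy
    have hq := combo_sub_mem (by linarith : 0 ≤ 1 - s) hs0.le hq₁ hq₂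
    have hyeq : (1 - s) • b +
        s • (((⟨b, hb⟩ : Y₀ A P Q) + s⁻¹ • (y - ⟨b, hb⟩) : Y₀ A P Q) : Y) = y := by
      simp only [Submodule.coe_add, Submodule.coe_smul, Submodule.coe_sub, smul_add, smul_smul,
        mul_inv_cancel₀ hs0.ne']
      module
    rw [hyeq] at hq
    refine (valueFun_le (combo_mem (by linarith) hs0.le hx₁ hx₂) hq).trans_lt
      (lt_of_le_of_lt ?_ hta)
    rw [EReal.coe_le_coe_iff]
    simp only [map_add, map_smul, smul_eq_mul]
    nlinarith

theorem isCompact_dualSol (hsub : SublevelCondition A P Q c b) (htop : Y₀ A P Q = ⊤)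
    {g₀ : Y →L[ℝ] ℝ} (hg₀ : g₀ ∈ dualSol A P Q c b) :
    IsCompact (StrongDual.toWeakDual '' dualSol A P Q c b) := by
  obtain ⟨l, hb, hn⟩ := hsub
  have hS : costSublevel A P Q c l ∈ 𝓝 b := by
    rw [← map_nhds_subtype_coe_eq_nhds hb (.of_forall fun y => htop ▸ trivial)]
    exact hn
  let W : Set Y := {v | b + v ∈ costSublevel A P Q c l ∧ b + -v ∈ costSublevel A P Q c l}
  have hW : W ∈ 𝓝 (0 : Y) := by
    have h1 : Tendsto (fun v : Y => b + v) (𝓝 0) (𝓝 b) := by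
      have : Continuous fun v : Y => b + v := by fun_prop
      simpa using this.tendsto 0
    have h2 : Tendsto (fun v : Y => b + -v) (𝓝 0) (𝓝 b) := by
      have : Continuous fun v : Y => b + -v := by fun_prop
      simpa using this.tendsto 0
    exact inter_mem (h1 hS) (h2 hS)
  have himage : StrongDual.toWeakDual '' dualSol A P Q c b =
      {g : WeakDual ℝ Y | (∀ q ∈ Q, 0 ≤ g q) ∧ (∀ x ∈ P, g (A x) ≤ c x) ∧ g₀ b ≤ g b} := by
    ext g
    constructor
    · rintro ⟨g, hg, rfl⟩
      have := mem_dualFeasible.1 hg.1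
      exact ⟨this.1, this.2, hg.2 _ hg₀.1⟩
    · rintro ⟨h1, h2, h3⟩
      exact ⟨WeakDual.toStrongDual g, ⟨mem_dualFeasible.2 ⟨h1, h2⟩,
        fun g' hg' => (hg₀.2 g' hg').trans h3⟩, rfl⟩
  rw [himage]
  refine (WeakDual.isCompact_setOf_abs_le hW (l - g₀ b)).of_isClosed_subset ?_ ?_
  · refine IsClosed.inter (s₁ := {g : WeakDual ℝ Y | ∀ q ∈ Q, 0 ≤ g q}) ?_
      (IsClosed.inter (s₁ := {g : WeakDual ℝ Y | ∀ x ∈ P, g (A x) ≤ c x}) ?_ ?_)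
    · simp only [ofPred_forall]
      exact isClosed_biInter fun q _ => isClosed_le continuous_const (WeakDual.eval_continuous q)
    · simp only [ofPred_forall]
      exact isClosed_biInter fun x _ =>
        isClosed_le (WeakDual.eval_continuous (A x)) continuous_const
    · exact isClosed_le continuous_const (WeakDual.eval_continuous b)
  · rintro g ⟨h1, h2, h3⟩ v ⟨hv, hv'⟩
    have hg : WeakDual.toStrongDual g ∈ dualFeasible A P Q c := mem_dualFeasible.2 ⟨h1, h2⟩
    -- Weak duality at `b + u` gives `g b + g u ≤ l`, and optimality gives `g b ≥ g₀ b`.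
    have key : ∀ u, b + u ∈ costSublevel A P Q c l → g u ≤ l - g₀ b := by
      intro u hu
      have := (le_valueFun hg (b + u)).trans (valueFun_le_of_mem_costSublevel hu)
      rw [EReal.coe_le_coe_iff, map_add] at this
      simp only [WeakDual.toStrongDual_apply] at this
      linarith
    have hneg := key _ hv'
    rw [map_neg] at hneg
    exact abs_le.2 ⟨by linarith, key _ hv⟩

end Topological

/-! ### The Fréchet case -/

section Frechet

variable {E : Type*} [AddCommGroup E] [Module ℝ E] [TopologicalSpace E]
  [IsTopologicalAddGroup E] [ContinuousSMul ℝ E] [LocallyConvexSpace ℝ E]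

theorem IsFrechet.baireSpace_of_isClosed (h : IsFrechet E) {L : Submodule ℝ E}
    (hL : IsClosed (L : Set E)) : BaireSpace L := by
  obtain ⟨hm, hc⟩ := h
  let : UniformSpace E := IsTopologicalAddGroup.rightUniformSpace E
  have : IsUniformAddGroup E := isUniformAddGroup_of_addCommGroup
  have : (uniformity E).IsCountablyGenerated :=
    IsUniformAddGroup.uniformity_countably_generated
  have : TopologicalSpace.IsCompletelyPseudoMetrizableSpace E := by
    let := UniformSpace.pseudoMetricSpace E
    infer_instance
  have : TopologicalSpace.IsCompletelyPseudoMetrizableSpace L :=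
    hL.isClosedEmbedding_subtypeVal.IsCompletelyPseudoMetrizableSpace
  infer_instance

variable {X Y : Type*}
  [AddCommGroup X] [Module ℝ X] [TopologicalSpace X] [IsTopologicalAddGroup X]
  [ContinuousSMul ℝ X] [LocallyConvexSpace ℝ X]
  [AddCommGroup Y] [Module ℝ Y] [TopologicalSpace Y] [IsTopologicalAddGroup Y]
  [ContinuousSMul ℝ Y] [LocallyConvexSpace ℝ Y]
  {A : X →L[ℝ] Y} {P : PointedCone ℝ X} {Q : PointedCone ℝ Y} {c : X →L[ℝ] ℝ} {b : Y}

theorem SublevelCondition.of_isFrechet (hX : IsFrechet X) (hY : IsFrechet Y)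
    (hP : IsClosed (P : Set X)) (hQ : IsClosed (Q : Set Y))
    (hL : IsClosed (Y₀ A P Q : Set Y)) (hb : b ∈ icr (imageDiff A P Q)) :
    SublevelCondition A P Q c b := by
  obtain ⟨x₀, hx₀, hq₀⟩ := mem_imageDiff.1 hb.1
  have := hY.baireSpace_of_isClosed hL
  have := hY.1
  have : FirstCountableTopology (Y₀ A P Q) :=
    Topology.IsInducing.subtypeVal.firstCountableTopology
  obtain ⟨_, _⟩ := hX
  let : UniformSpace X := IsTopologicalAddGroup.rightUniformSpace X
  have : IsUniformAddGroup X := isUniformAddGroup_of_addCommGroup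
  -- The feasibility relation recentred at `(x₀, b)`. Its openness on `{x | c x < 1}` bounds the
  -- cost by `c x₀ + 1`.
  let G : Set (X × Y₀ A P Q) := {p | x₀ + p.1 ∈ P ∧ A (x₀ + p.1) - (b + (p.2 : Y)) ∈ Q}
  have hGcl : IsClosed G := by
    refine IsClosed.inter (s₁ := {p : X × Y₀ A P Q | x₀ + p.1 ∈ P})
      (hP.preimage (f := fun p : X × Y₀ A P Q => x₀ + p.1) (by fun_prop))
      (hQ.preimage (f := fun p : X × Y₀ A P Q => A (x₀ + p.1) - (b + (p.2 : Y))) (by fun_prop))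
  have hGc : Convex ℝ G := by
    rintro p ⟨hp, hp'⟩ q ⟨hq, hq'⟩ s t hs ht hst
    have hx : x₀ + (s • p + t • q).1 = s • (x₀ + p.1) + t • (x₀ + q.1) := by
      obtain rfl : s = 1 - t := by linarith
      simp only [Prod.fst_add, Prod.smul_fst]
      module
    have hy : b + ((s • p + t • q).2 : Y) = s • (b + (p.2 : Y)) + t • (b + (q.2 : Y)) := by
      obtain rfl : s = 1 - t := by linarith
      simp only [Prod.snd_add, Prod.smul_snd, Submodule.coe_add, Submodule.coe_smul]
      module
    refine ⟨?_, ?_⟩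
    · rw [hx]
      exact combo_mem hs ht hp hq
    · rw [hx, hy]
      exact combo_sub_mem hs ht hp' hq'
  have hG0 : (0 : X × Y₀ A P Q) ∈ G := ⟨by simpa using hx₀, by simpa using hq₀⟩
  have hU : {x : X | c x < 1} ∈ 𝓝 (0 : X) :=
    c.continuous.continuousAt.eventually_lt continuousAt_const (by simp)
  refine .of_nhds_zero (l := c x₀ + 1) (imageDiff_subset hb.1)
    (mem_of_superset (hGcl.relation_image_mem_nhds hGc hG0 (fun z => ?_) hU) ?_)
  · obtain ⟨δ, hδ, x, hx, hq⟩ := exists_feasible_of_mem_icr hb z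
    exact ⟨δ, hδ, x - x₀, by simpa using hx, by simpa using hq⟩
  · rintro z ⟨x, hx, hxP, hxQ⟩
    refine ⟨x₀ + x, hxP, hxQ, ?_⟩
    rw [map_add]
    have : c x < 1 := hx
    linarith

end Frechet

end ConicLP

theorem proposition3 {X Y : Type*}
    [AddCommGroup X] [Module ℝ X] [TopologicalSpace X] [IsTopologicalAddGroup X]
    [ContinuousSMul ℝ X] [LocallyConvexSpace ℝ X] [T2Space X]
    [AddCommGroup Y] [Module ℝ Y] [TopologicalSpace Y] [IsTopologicalAddGroup Y]
    [ContinuousSMul ℝ Y] [LocallyConvexSpace ℝ Y] [T2Space Y]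
    (A : X →L[ℝ] Y) (P : PointedCone ℝ X) (Q : PointedCone ℝ Y)
    (c : X →L[ℝ] ℝ) (b : Y)
    (hyp : SublevelCondition A P Q c b ∨
      SlaterCondition A P Q b ∨
      (IsFrechet X ∧ IsFrechet Y ∧ IsClosed (P : Set X) ∧ IsClosed (Q : Set Y) ∧
        IsClosed (Y₀ A P Q : Set Y) ∧ b ∈ icr (imageDiff A P Q)) ∨
      (FiniteDimensional ℝ (Y₀ A P Q) ∧ b ∈ icr (imageDiff A P Q))) :
    (AlternativeA A P Q c ∨ AlternativeB A P Q c b) ∧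
    (AlternativeA A P Q c → primalVal A P Q c b = ⊥ ∧ dualVal A P Q c b = ⊥) ∧
    (AlternativeB A P Q c b →
      (subdiff (valueFun A P Q c) b).Nonempty ∧
      (∃ r : ℝ, primalVal A P Q c b = (r : EReal) ∧ dualVal A P Q c b = (r : EReal)) ∧
      (dualSol A P Q c b).Nonempty ∧
      (Y₀ A P Q = ⊤ → IsCompact (StrongDual.toWeakDual '' dualSol A P Q c b))) := by
  have hsub : SublevelCondition A P Q c b := by
    rcases hyp with h | h | ⟨hX, hY, hP, hQ, hL, hb⟩ | ⟨_, hb⟩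
    · exact h
    · exact h.sublevelCondition
    · exact .of_isFrechet hX hY hP hQ hL hb
    · exact .of_finiteDimensional hb
  have hle : ∃ l : ℝ, valueFun A P Q c b ≤ l := by
    obtain ⟨l, _, hn⟩ := hsub
    exact ⟨l, valueFun_le_of_mem_costSublevel (mem_costSublevel_of_preimage_mem_nhds hn)⟩
  have hreal : valueFun A P Q c b ≠ ⊥ → ∃ g ∈ dualFeasible A P Q c,
      valueFun A P Q c b = (g b : ℝ) := by
    intro hbot
    obtain ⟨l, hl⟩ := hle
    have hr := EReal.coe_toReal (ne_top_of_le_ne_top (EReal.coe_ne_top l) hl) hbot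
    obtain ⟨g, hg, hgb⟩ := exists_dualFeasible_ge hsub hr.symm
    refine ⟨g, hg, le_antisymm ?_ (le_valueFun hg b)⟩
    rw [← hr]
    exact EReal.coe_le_coe_iff.2 hgb
  refine ⟨?_, fun ha => ?_, fun hB => ?_⟩
  · by_cases hbot : valueFun A P Q c b = ⊥
    · exact Or.inl fun y hy => valueFun_eq_bot_of_mem_icr hbot hy
    · obtain ⟨g, hg, hgb⟩ := hreal hbot
      exact Or.inr ⟨mem_posDual_add_of_dualFeasible hg, continuousAt_valueFun hsub hg hgb⟩
  · have hp : primalVal A P Q c b = ⊥ := by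
      rw [← valueFun_eq_primalVal]
      exact ha b hsub.mem_icr
    exact ⟨hp, le_bot_iff.1 (hp ▸ dualVal_le_primalVal)⟩
  · obtain ⟨g', hg'⟩ := dualFeasible_nonempty hB.1
    -- Any dual feasible point bounds `h_c(b)` from below, which excludes `-∞`.
    obtain ⟨g, hg, hgb⟩ := hreal
      ((EReal.bot_lt_coe _).trans_le (le_valueFun hg' b)).ne'
    have hsol : g ∈ dualSol A P Q c b := ⟨hg, fun g' hg' => by
      have := le_valueFun hg' b
      rwa [hgb, EReal.coe_le_coe_iff] at this⟩
    have hp : primalVal A P Q c b = (g b : ℝ) := (valueFun_eq_primalVal b).symm.trans hgb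
    refine ⟨⟨g, ⟨by simp [hgb], by simp [hgb]⟩, fun y => ?_⟩,
      ⟨g b, hp, le_antisymm (hp ▸ dualVal_le_primalVal) (le_iSup₂_of_le g hg le_rfl)⟩,
      ⟨g, hsol⟩, fun htop => isCompact_dualSol hsub htop hsol⟩
    rw [hgb, map_sub, EReal.coe_sub]
    exact EReal.sub_le_sub (le_valueFun hg y) le_rfl
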